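/- Definitions. An \emph{Adinkra with $N\ge 1$ colors} is a non-empty finite bipartite simple graph $(V,E)$ with a signature $\mu\colon E\to\{-1,1\}$ (edges with $\mu=-1$ are called dashed), an assignment of one of $N$ colors to each edge, and a function $h\colon V\to\mathbb Z$, such that: each vertex is incident to exactly $N$ edges, one of each color; for any two distinct colors, the subgraph formed by the edges of these two colors is a disjoint union of $4$-cycles; each of these $4$-cycles contains an odd number of dashed edges; and $|h(v)-h(w)|=1$ for adjacent vertices $v,w$. Its \emph{signed Laplacian} is the $V\times V$ integer matrix $L$ with $L_{vv}=\deg(v)$, $L_{vw}=-\mu(vw)$ if $v\neq w$ are adjacent, and $L_{vw}=0$ otherwise. A linear code $C\subseteq\mathbb F_2^N$ (a linear subspace) is \emph{doubly even} if the number of ones in every codeword is divisible by $4$. The \emph{quotient of the $N$-cube by $C$} is the graph whose vertices are the cosets of $C$ in $\mathbb F_2^N$, in which two distinct cosets are adjacent if they have representatives that differ in exactly one coordinate. The \emph{invariant factors} of a square integer matrix $M$ are the non-negative integers $d_1\mid d_2\mid\cdots\mid d_n$ such that $PMQ=\mathrm{diag}(d_1,\dots,d_n)$ for some integer matrices $P,Q$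 that are invertible over $\mathbb Z$. Statement. Let $C\subseteq\mathbb F_2^N$ be a doubly even linear code that does not contain the all-ones vector $\mathbf 1=(1,\dots,1)$, and let an Adinkra with $N$ colors and vertex set $V$ be given whose underlying graph is isomorphic to the quotient of the $N$-cube by $C$. Then the invariant factors of its signed Laplacian are $(1^{\#V/2},(N^2-N)^{\#V/2})$, where the exponents indicate multiplicities: the first $\#V/2$ invariant factors are $1$ and the remaining $\#V/2$ are $N^2-N$. -/

import Mathlib

/-- A signed graph on `V`: a simple graph together with a sign `1` or `-1` on each edge.
An edge with sign `-1` is called dashed. -/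
structure SignedGraph (V : Type*) where
  graph : SimpleGraph V
  sign : graph.edgeSet → ℤˣ

open Classical in
/-- The signed Laplacian: the degrees on the diagonal; off the diagonal, `-1` for a solid edge,
`1` for a dashed edge, and `0` for a non-edge. -/
noncomputable def SignedGraph.signedLaplacian {V : Type*} [Fintype V] (G : SignedGraph V) :
    Matrix V V ℤ :=
  Matrix.of fun v w =>
    if v = w then (G.graph.degree v : ℤ)
    else if h : G.graph.Adj v w then -((G.sign ⟨s(v, w), h⟩ : ℤˣ) : ℤ)
    else 0

/-- The spanning subgraph of `G` consisting of the edges whose color is `i` or `j`. -/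
def bicolorGraph {V K : Type*} (G : SimpleGraph V) (color : G.edgeSet → K) (i j : K) :
    SimpleGraph V :=
  SimpleGraph.fromEdgeSet {e | ∃ h : e ∈ G.edgeSet, color ⟨e, h⟩ = i ∨ color ⟨e, h⟩ = j}

/-- An Adinkra with `N` colors, with (finite) vertex set `V`. -/
structure Adinkra (N : ℕ) (V : Type*) [Fintype V] extends SignedGraph V where
  one_le : 1 ≤ N
  nonempty : Nonempty V
  bipartite : graph.IsBipartite
  color : graph.edgeSet → Fin N
  height : V → ℤ
  /-- Each vertex is incident to exactly one edge of each color. -/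
  existsUnique_edge : ∀ (v : V) (i : Fin N), ∃! e : graph.edgeSet, v ∈ e.1 ∧ color e = i
  /-- The edges of any two distinct colors form a disjoint union of 4-cycles. -/
  bicolor_cycle : ∀ i j : Fin N, i ≠ j →
    ∀ c : (bicolorGraph graph color i j).ConnectedComponent,
      Nonempty (c.toSimpleGraph ≃g SimpleGraph.cycleGraph 4)
  /-- Each bicolor cycle contains an odd number of dashed edges. -/
  totally_odd : ∀ i j : Fin N, i ≠ j →
    ∀ c : (bicolorGraph graph color i j).ConnectedComponent,
      Odd {e : graph.edgeSet |
        (∀ v ∈ e.1, v ∈ c.supp) ∧ (color e = i ∨ color e = j) ∧ sign e = -1}.ncard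
  height_adj : ∀ v w : V, graph.Adj v w → |height v - height w| = 1

/-- The `N`-cube: two words are adjacent if they differ in exactly one coordinate. -/
def cubeGraph (N : ℕ) : SimpleGraph (Fin N → ZMod 2) where
  Adj v w := hammingDist v w = 1
  symm := ⟨fun v w h => by rw [hammingDist_comm]; exact h⟩
  loopless := ⟨fun v h => by simp at h⟩

/-- A linear code is doubly even if the weight of every codeword is divisible by `4`. -/
def IsDoublyEven {N : ℕ} (C : Submodule (ZMod 2) (Fin N → ZMod 2)) : Prop :=
  ∀ c ∈ C, 4 ∣ hammingNorm c

/-- The quotient of the `N`-cube by a linear code `C`: the vertices are the cosets of `C`, and two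
distinct cosets are adjacent if they have representatives that are adjacent in the `N`-cube.
(If `C` is doubly even, then two representatives of one coset are never adjacent in the cube, and
two cosets are never joined by edges of two different colors, so that the quotient of the cube is a
simple graph.) -/
def cubeQuotient {N : ℕ} (C : Submodule (ZMod 2) (Fin N → ZMod 2)) :
    SimpleGraph ((Fin N → ZMod 2) ⧸ C) :=
  SimpleGraph.fromRel fun a b =>
    ∃ v w : Fin N → ZMod 2, C.mkQ v = a ∧ C.mkQ w = b ∧ (cubeGraph N).Adj v w

/-- `d = [d₁, d₂, …]` is the list of invariant factors of the square integer matrix `M`: each entry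
divides the next, and `M` has the Smith normal form `diag(d₁, d₂, …)`, that is, `P * M * Q` is this
diagonal matrix for some matrices `P`, `Q` that are invertible over `ℤ` (where `e` enumerates the
rows and columns of `M`; in particular `d` has as many entries as `M` has rows). -/
def HasInvariantFactors {V : Type*} [Fintype V] [DecidableEq V] (M : Matrix V V ℤ)
    (d : List ℕ) : Prop :=
  d.Pairwise (· ∣ ·) ∧
    ∃ (e : V ≃ Fin d.length) (P Q : Matrix.GeneralLinearGroup V ℤ),
      (P : Matrix V V ℤ) * M * (Q : Matrix V V ℤ) =
        Matrix.diagonal fun v => ((d.get (e v) : ℕ) : ℤ)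

/-! ### Diagonal forms of integer matrices and a criterion for invariant factors. -/

section MatrixTheory

open Matrix

variable {V : Type*} [Fintype V] [DecidableEq V]

/-! Let `S` be the signed adjacency matrix, `L = N - S` the signed Laplacian, `K = N + S` and `d = N
^ 2 - N`. The matrix `S` is a sum of one signed permutation matrix for each color. These square to
`1` and, by the odd dashing of the bicolor cycles, anticommute; hence `S * S = N` and `L * K = d`.
Conjugation by the signs of the bipartition exchanges `L` and `K`, so they have the same
determinant.

Suppose `d ≠ 0`. If `L` is equivalent to `diag a`, the inverse changes of bases bring `K` to `diag
(d / a)`. A relation `L * H + H' * K = c` then puts `c` into every ideal `(a v, d / a v)`. Over `ℤ`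
such a homotopy exists for `c = -2`, given by a single color matrix (`laplacian_homotopy`), so only
the prime `2` can divide both `a v` and `d / a v`. This prime is excluded by a homotopy for `c = 1`
over `ZMod 2` (`laplacian_homotopy_mod_two`). There the signs disappear and `S` becomes a sum of
translations of the group of cosets of `C`; the hypothesis on the all-ones vector supplies a
functional that is `1` on an odd number of the generators.

So every `a v` is a unitary divisor of `d`. As the `a v` form a divisibility chain and `L` and `K`
have equal determinants, half of them are `1` and half are `d`
(`exists_enumeration_of_unitary_divisors`). The case `N = 1`, where `d = 0`, is settled by explicit
row and column operations. -/

theorem exists_mul_mul_eq_diagonal (M : Matrix V V ℤ) (hM : M.det ≠ 0) :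
    ∃ (P Q : GeneralLinearGroup V ℤ) (a : V → ℤ),
      (P : Matrix V V ℤ) * M * (Q : Matrix V V ℤ) = diagonal a := by
  have hinj : Function.Injective M.mulVecLin := by
    intro x y hxy
    exact Matrix.mulVec_injective_of_det_ne_zero hM hxy
  let std := Pi.basisFun ℤ V
  obtain ⟨b, a, ab, h⟩ := Submodule.exists_smith_normal_form_of_rank_eq (N := LinearMap.range M.mulVecLin) std
    (LinearMap.finrank_range_of_inj hinj)
  let e := LinearEquiv.ofInjective M.mulVecLin hinj
  let x := ab.map e.symm
  have hx (i) : M *ᵥ x i = a i • b i := by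
    rw [← h i]
    have : (e (e.symm (ab i)) : V → ℤ) = ab i := by simp
    rw [← this]
    rfl
  refine ⟨⟨b.toMatrix std, std.toMatrix b, b.toMatrix_mul_toMatrix_flip std,
    std.toMatrix_mul_toMatrix_flip b⟩, ⟨std.toMatrix x, x.toMatrix std,
    std.toMatrix_mul_toMatrix_flip x, x.toMatrix_mul_toMatrix_flip std⟩, a, ?_⟩
  -- The elements `a i • b i` are a basis of the image lattice of `M`, and `x i` is the preimage of
  -- `a i • b i`.
  have key : M * std.toMatrix x = std.toMatrix b * diagonal a := by
    ext v i
    rw [mul_diagonal]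
    have := congrFun (hx i) v
    simpa [std, Matrix.mul_apply, Matrix.mulVec, dotProduct, Module.Basis.toMatrix_apply, mul_comm] using this
  change b.toMatrix std * M * std.toMatrix x = diagonal a
  rw [mul_assoc, key, ← mul_assoc, Module.Basis.toMatrix_mul_toMatrix_flip, one_mul]

theorem exists_mul_mul_eq_diagonal_natCast (M : Matrix V V ℤ) (hM : M.det ≠ 0) :
    ∃ (P Q : GeneralLinearGroup V ℤ) (a : V → ℕ),
      (P : Matrix V V ℤ) * M * (Q : Matrix V V ℤ) = diagonal fun v => (a v : ℤ) := by
  obtain ⟨P, Q, a, h⟩ := exists_mul_mul_eq_diagonal M hM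
  have hs (v) : ∃ s : ℤ, s * s = 1 ∧ s * a v = (a v).natAbs := by
    rcases Int.natAbs_eq (a v) with h | h
    · exact ⟨1, by simp, by omega⟩
    · exact ⟨-1, by simp, by omega⟩
  choose s hs1 hs2 using hs
  have hss : diagonal s * diagonal s = 1 := by
    rw [diagonal_mul_diagonal, ← diagonal_one]
    exact congrArg _ (funext hs1)
  refine ⟨⟨diagonal s, diagonal s, hss, hss⟩ * P, Q, fun v => (a v).natAbs, ?_⟩
  rw [Units.val_mul, mul_assoc, mul_assoc, ← mul_assoc (P : Matrix V V ℤ), h, diagonal_mul_diagonal]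
  exact congrArg _ (funext hs2)

/-- The two by two matrix with entries `p q r s`, acting on the coordinates `i` and `j`. -/
def planeMatrix (i j : V) (p q r s : ℤ) : Matrix V V ℤ :=
  1 + (p - 1) • single i i 1 + q • single i j 1 + r • single j i 1 + (s - 1) • single j j 1

theorem planeMatrix_mul {i j : V} (hij : i ≠ j) (p q r s p' q' r' s' : ℤ) :
    planeMatrix i j p q r s * planeMatrix i j p' q' r' s' =
      planeMatrix i j (p * p' + q * r') (p * q' + q * s') (r * p' + s * r') (r * q' + s * s') := by
  simp only [planeMatrix, mul_add, add_mul, smul_mul_assoc, mul_smul_comm, one_mul, mul_one,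
    single_mul_single_same, single_mul_single_of_ne _ _ _ _ hij,
    single_mul_single_of_ne _ _ _ _ hij.symm, smul_zero]
  module

omit [Fintype V] in
theorem planeMatrix_one (i j : V) : planeMatrix i j 1 0 0 1 = 1 := by
  simp [planeMatrix]

/-- Splits off the two entries at `i` and `j`. The remaining factor commutes with plane matrices,
which reduces the exchange of two diagonal entries to a computation with two by two matrices. -/
theorem diagonal_eq_planeMatrix_mul {i j : V} (hij : i ≠ j) (a : V → ℤ) (x y : ℤ) :
    diagonal (Function.update (Function.update a i x) j y) =
      planeMatrix i j x 0 0 y * diagonal (Function.update (Function.update a i 1) j 1) := by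
  ext v w
  rw [mul_diagonal]
  simp only [planeMatrix, diagonal_apply, Matrix.add_apply, Matrix.smul_apply, single_apply, one_apply]
  by_cases hv : v = j
  · subst hv
    by_cases hw : v = w
    · subst hw; simp [hij]
    · simp [hw, hij]
  · by_cases hvi : v = i
    · subst hvi
      by_cases hw : v = w
      · subst hw; simp [hij, hij.symm]
      · simp [hw, hij.symm]
    · by_cases hw : v = w
      · subst hw; simp [hv, hvi, Ne.symm hv, Ne.symm hvi]
      · simp [hw, Ne.symm hv, Ne.symm hvi]

theorem planeMatrix_mul_diagonal_comm {i j : V} (hij : i ≠ j) (a : V → ℤ) (p q r s : ℤ) :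
    planeMatrix i j p q r s * diagonal (Function.update (Function.update a i 1) j 1) =
      diagonal (Function.update (Function.update a i 1) j 1) * planeMatrix i j p q r s := by
  ext v w
  rw [mul_diagonal, diagonal_mul]
  simp only [planeMatrix, Matrix.add_apply, Matrix.smul_apply, single_apply, one_apply, Function.update_apply]
  grind

theorem exists_eq_gcd_mul_and_lcm_eq {a b : ℕ} (ha : a ≠ 0) :
    ∃ x y, a = a.gcd b * x ∧ b = a.gcd b * y ∧ a.lcm b = a.gcd b * x * y := by
  obtain ⟨x, hx⟩ := Nat.gcd_dvd_left a b
  obtain ⟨y, hy⟩ := Nat.gcd_dvd_right a b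
  refine ⟨x, y, hx, hy, ?_⟩
  apply Nat.eq_of_mul_eq_mul_left (Nat.gcd_pos_of_pos_left b (Nat.pos_of_ne_zero ha))
  rw [Nat.gcd_mul_lcm, ← hx, mul_left_comm, ← hy]

theorem exists_mul_diagonal_mul_eq_gcd_lcm {i j : V} (hij : i ≠ j) (a : V → ℕ) (hi : a i ≠ 0) :
    ∃ P Q : GeneralLinearGroup V ℤ,
      (P : Matrix V V ℤ) * (diagonal fun v => (a v : ℤ)) * (Q : Matrix V V ℤ) =
        diagonal fun v => (Function.update (Function.update a i ((a i).gcd (a j))) j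
          ((a i).lcm (a j)) v : ℤ) := by
  obtain ⟨x, y, hx, hy, hl⟩ := exists_eq_gcd_mul_and_lcm_eq (b := a j) hi
  have hg : 0 < (a i).gcd (a j) := Nat.gcd_pos_of_pos_left _ (Nat.pos_of_ne_zero hi)
  have hb := Nat.gcd_eq_gcd_ab (a i) (a j)
  set g := (a i).gcd (a j)
  set s := (a i).gcdA (a j)
  set t := (a i).gcdB (a j)
  have hst : (x : ℤ) * s + y * t = 1 := by
    have hg' : (g : ℤ) ≠ 0 := by exact_mod_cast hg.ne'
    apply mul_left_cancel₀ hg'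
    rw [hx, hy] at hb
    push_cast at hb
    linear_combination -hb
  have one_of {p q r s : ℤ} (h : p = 1 ∧ q = 0 ∧ r = 0 ∧ s = 1) :
      planeMatrix i j p q r s = 1 := by
    obtain ⟨rfl, rfl, rfl, rfl⟩ := h
    exact planeMatrix_one i j
  -- With `a i = g * x`, `a j = g * y` and `x * s + y * t = 1`, the row operation `(s, t; -y, x)`
  -- and the column operation `(1, -t * y; 1, s * x)` have determinant `1` and turn `diag (g * x, g
  -- * y)` into `diag (g, g * x * y)`.
  refine ⟨⟨planeMatrix i j s t (-y) x, planeMatrix i j x (-t) y s, ?_, ?_⟩,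
    ⟨planeMatrix i j 1 (-t * y) 1 (s * x), planeMatrix i j (s * x) (t * y) (-1) 1, ?_, ?_⟩, ?_⟩
  iterate 4
    rw [planeMatrix_mul hij]
    exact one_of ⟨by linear_combination hst, by ring, by ring, by linear_combination hst⟩
  have e1 : (fun v => (a v : ℤ)) =
      Function.update (Function.update (fun v => (a v : ℤ)) i (a i)) j (a j) := by simp
  have e2 : (fun v => (Function.update (Function.update a i g) j ((a i).lcm (a j)) v : ℤ)) =
      Function.update (Function.update (fun v => (a v : ℤ)) i g) j ((a i).lcm (a j)) := by
    ext v
    simp only [Function.update_apply]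
    split_ifs <;> rfl
  rw [e1, e2, diagonal_eq_planeMatrix_mul hij, diagonal_eq_planeMatrix_mul hij _ (g : ℤ)]
  change planeMatrix i j s t (-y) x * _ * planeMatrix i j 1 (-t * y) 1 (s * x) = _
  rw [← mul_assoc, mul_assoc _ (diagonal _), ← planeMatrix_mul_diagonal_comm hij, ← mul_assoc,
    planeMatrix_mul hij, planeMatrix_mul hij]
  congr 1
  rw [hl]
  have hx' : (a i : ℤ) = g * x := by exact_mod_cast hx
  have hy' : (a j : ℤ) = g * y := by exact_mod_cast hy
  rw [hx', hy']
  push_cast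
  congr 1
  · linear_combination (g : ℤ) * hst
  · ring
  · ring
  · linear_combination (g * x * y : ℤ) * hst

/-- Every nonsingular integer matrix that divides `d` is equivalent to a diagonal matrix
with nonnegative entries any two of which are comparable under divisibility. -/
theorem exists_diagonal_dvd_total (L K : Matrix V V ℤ) {d : ℕ} (hd : d ≠ 0)
    (hLK : L * K = (d : ℤ) • 1) :
    ∃ (P Q : GeneralLinearGroup V ℤ) (a : V → ℕ),
      (P : Matrix V V ℤ) * L * (Q : Matrix V V ℤ) = (diagonal fun v => (a v : ℤ)) ∧
      (∀ v, a v ∣ d) ∧ ∀ v w, a v ∣ a w ∨ a w ∣ a v := by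
  have hdet : L.det ≠ 0 := by
    intro h0
    have := congrArg det hLK
    rw [det_mul, h0, zero_mul, det_smul, det_one, mul_one] at this
    exact pow_ne_zero _ (by exact_mod_cast hd) this.symm
  let T : Set (V → ℕ) := {a | ∃ P Q : GeneralLinearGroup V ℤ,
    (P : Matrix V V ℤ) * L * (Q : Matrix V V ℤ) = diagonal fun v => (a v : ℤ)}
  have hdvd : ∀ a ∈ T, ∀ v, a v ∣ d := by
    rintro a ⟨P, Q, h⟩ v
    have h1 : (diagonal fun v => (a v : ℤ)) * ((Q⁻¹ : GeneralLinearGroup V ℤ) * K *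
        (P⁻¹ : GeneralLinearGroup V ℤ) : Matrix V V ℤ) = (d : ℤ) • 1 := by
      rw [← h]
      calc _ = (P : Matrix V V ℤ) * (L * ((Q * Q⁻¹ : GeneralLinearGroup V ℤ) : Matrix V V ℤ) * K) *
            ((P⁻¹ : GeneralLinearGroup V ℤ) : Matrix V V ℤ) := by
              rw [Units.val_mul]; noncomm_ring
        _ = (d : ℤ) • 1 := by
          rw [mul_inv_cancel, Units.val_one, mul_one, hLK, mul_smul_comm, mul_one, smul_mul_assoc,
            ← Units.val_mul, mul_inv_cancel, Units.val_one]
    have h2 := congrFun (congrFun h1 v) v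
    rw [diagonal_mul] at h2
    simp only [Matrix.smul_apply, one_apply_eq, smul_eq_mul, mul_one] at h2
    exact_mod_cast Dvd.intro _ h2
  have hfin : T.Finite := by
    refine Set.Finite.subset (Set.Finite.pi' fun _ => Set.finite_Iic d) ?_
    intro a ha v
    exact Nat.le_of_dvd (Nat.pos_of_ne_zero hd) (hdvd a ha v)
  have hne : T.Nonempty := by
    obtain ⟨P, Q, a, h⟩ := exists_mul_mul_eq_diagonal_natCast L hdet
    exact ⟨a, P, Q, h⟩
  -- Among the finitely many diagonal forms, take one with the largest sum of entries: replacing two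
  -- incomparable entries by their gcd and lcm would increase the sum.
  obtain ⟨a, ha, hmax⟩ := Set.exists_max_image T (fun a => ∑ v, a v) hfin hne
  have ha' := hdvd a ha
  obtain ⟨P, Q, h⟩ := ha
  refine ⟨P, Q, a, h, ha', fun i j => ?_⟩
  by_contra hcon
  push Not at hcon
  have hij : i ≠ j := by rintro rfl; exact hcon.1 dvd_rfl
  have hpos (v) : 0 < a v := Nat.pos_of_dvd_of_pos (ha' v) (Nat.pos_of_ne_zero hd)
  obtain ⟨P', Q', h'⟩ := exists_mul_diagonal_mul_eq_gcd_lcm hij a (hpos i).ne'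
  have hle := hmax (Function.update (Function.update a i ((a i).gcd (a j))) j
    ((a i).lcm (a j))) ⟨P' * P, Q * Q', by rw [← h', ← h]; simp only [Units.val_mul, mul_assoc]⟩
  have hj : j ∈ Finset.univ \ {i} := by simp [hij.symm]
  have hsum (f : V → ℕ) : ∑ v, f v = f i + (f j + ∑ v ∈ (Finset.univ \ {i}) \ {j}, f v) := by
    rw [Finset.sum_eq_add_sum_sdiff_singleton_of_mem (Finset.mem_univ i),
      Finset.sum_eq_add_sum_sdiff_singleton_of_mem hj]
  rw [hsum a, hsum] at hle
  have hrest : ∑ v ∈ (Finset.univ \ {i}) \ {j}, Function.update (Function.update a i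
      ((a i).gcd (a j))) j ((a i).lcm (a j)) v = ∑ v ∈ (Finset.univ \ {i}) \ {j}, a v := by
    refine Finset.sum_congr rfl fun v hv => ?_
    simp only [Finset.mem_sdiff, Finset.mem_singleton] at hv
    rw [Function.update_of_ne hv.2, Function.update_of_ne hv.1.2]
  rw [hrest, Function.update_self, Function.update_of_ne hij, Function.update_self] at hle
  -- The difference of the two sides is `g * (x - 1) * (y - 1)`, and incomparability means that `x`
  -- and `y` are both at least `2`.
  have hlt : a i + a j < (a i).gcd (a j) + (a i).lcm (a j) := by
    obtain ⟨x, y, hx, hy, hl⟩ := exists_eq_gcd_mul_and_lcm_eq (b := a j) (hpos i).ne'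
    have hg : 0 < (a i).gcd (a j) := Nat.gcd_pos_of_pos_left _ (hpos i)
    have hx1 : x ≠ 1 := by
      rintro rfl
      exact hcon.1 (by conv_lhs => rw [hx, mul_one]
                       exact Nat.gcd_dvd_right _ _)
    have hy1 : y ≠ 1 := by
      rintro rfl
      exact hcon.2 (by conv_lhs => rw [hy, mul_one]
                       exact Nat.gcd_dvd_left _ _)
    have hx0 : x ≠ 0 := by rintro rfl; have := hpos i; simp at hx; omega
    have hy0 : y ≠ 0 := by rintro rfl; have := hpos j; simp at hy; omega
    rw [hl]
    generalize (a i).gcd (a j) = g at *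
    rw [hx, hy]
    obtain ⟨x, rfl⟩ : ∃ k, x = k + 2 := ⟨x - 2, by omega⟩
    obtain ⟨y, rfl⟩ : ∃ k, y = k + 2 := ⟨y - 2, by omega⟩
    have : g * (x + 2) + g * (y + 2) + g * ((x + 1) * (y + 1)) = g + g * (x + 2) * (y + 2) := by ring
    have : 0 < g * ((x + 1) * (y + 1)) := by positivity
    omega
  omega

omit [DecidableEq V] in
theorem exists_sorting_equiv {n : ℕ} (hn : Fintype.card V = n) (a : V → ℕ) :
    ∃ e : V ≃ Fin n, ∀ v w, e v ≤ e w → a v ≤ a w := by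
  let e := Fintype.equivFinOfCardEq hn
  refine ⟨e.trans (Tuple.sort (a ∘ e.symm)).symm, fun v w h => ?_⟩
  have := Tuple.monotone_sort (a ∘ e.symm) h
  simpa using this

/-- A sequence of unitary divisors of `d` that is totally ordered by divisibility and has product
`d ^ m`, where `2 * m` is its length, consists of `m` ones and `m` times `d`. -/
theorem exists_enumeration_of_unitary_divisors {m d : ℕ} (hd : d ≠ 0)
    (hcard : Fintype.card V = m + m) (a : V → ℕ) (hdvd : ∀ v, a v ∣ d)
    (hcop : ∀ v, (a v).Coprime (d / a v)) (htot : ∀ v w, a v ∣ a w ∨ a w ∣ a v)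
    (hprod : ∏ v, a v = d ^ m) :
    ∃ e : V ≃ Fin (m + m), ∀ v, a v = if (e v : ℕ) < m then 1 else d := by
  obtain ⟨e, he⟩ := exists_sorting_equiv hcard a
  have hpos (v) : 0 < a v := Nat.pos_of_dvd_of_pos (hdvd v) (Nat.pos_of_ne_zero hd)
  have hchain (v w) (h : e v ≤ e w) : a v ∣ a w := by
    rcases htot v w with h' | h'
    · exact h'
    · rw [le_antisymm (he v w h) (Nat.le_of_dvd (hpos v) h')]
  let S : Finset V := Finset.univ.filter fun v => (e v : ℕ) < m
  have hScard : Sᶜ.card = m := by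
    have : Sᶜ = (Finset.univ.map (Fin.natAddEmb m)).map e.symm.toEmbedding := by
      ext v
      simp only [S, Finset.mem_compl, Finset.mem_filter, Finset.mem_univ, true_and, not_lt,
        Finset.mem_map, Fin.natAddEmb_apply, Equiv.coe_toEmbedding, exists_exists_eq_and,
        Equiv.symm_apply_eq]
      constructor
      · intro h
        exact ⟨⟨e v - m, by omega⟩, by ext; simp; omega⟩
      · rintro ⟨x, hx⟩
        rw [← hx]; simp
    rw [this]; simp
  -- `S` is the smaller half of the chain. Since `Sᶜ` has `m` elements, `d ^ m` is the product of `d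
  -- / a v * a v` over `Sᶜ`; cancel the factors `a v`.
  have hX : ∏ v ∈ S, a v = ∏ v ∈ Sᶜ, d / a v := by
    have hY : 0 < ∏ v ∈ Sᶜ, a v := Finset.prod_pos fun v _ => hpos v
    apply Nat.eq_of_mul_eq_mul_right hY
    rw [Finset.prod_mul_prod_compl, hprod, ← Finset.prod_mul_distrib,
      Finset.prod_congr rfl (fun v _ => Nat.div_mul_cancel (hdvd v)), Finset.prod_const, hScard]
  -- For `v` in `S` and `w` outside, `a v` divides `a w`, which is coprime to `d / a w`. The two
  -- equal products are therefore coprime, hence `1`.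
  have hc : (∏ v ∈ S, a v).Coprime (∏ v ∈ Sᶜ, d / a v) := by
    refine Nat.Coprime.prod_left fun v hv => Nat.Coprime.prod_right fun w hw => ?_
    refine Nat.Coprime.coprime_dvd_left (hchain v w ?_) (hcop w)
    simp only [S, Finset.mem_compl, Finset.mem_filter, Finset.mem_univ, true_and] at hv hw
    exact Fin.le_def.2 (by omega)
  have h1 : ∏ v ∈ S, a v = 1 := by
    rw [← hX] at hc
    exact (Nat.coprime_self _).1 hc
  have h2 := hX.symm.trans h1
  rw [Finset.prod_eq_one_iff] at h1 h2
  refine ⟨e, fun v => ?_⟩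
  split_ifs with hv
  · exact h1 v (by simpa [S] using hv)
  · have := h2 v (by simpa [S] using hv)
    have h3 := Nat.div_mul_cancel (hdvd v)
    rw [this, one_mul] at h3
    exact h3

theorem hasInvariantFactors_of_diagonal {M : Matrix V V ℤ} {m d : ℕ}
    (P Q : GeneralLinearGroup V ℤ) (a : V → ℕ)
    (h : (P : Matrix V V ℤ) * M * (Q : Matrix V V ℤ) = diagonal fun v => (a v : ℤ))
    (e : V ≃ Fin (m + m)) (he : ∀ v, a v = if (e v : ℕ) < m then 1 else d) :
    HasInvariantFactors M (List.replicate m 1 ++ List.replicate m d) := by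
  refine ⟨?_, e.trans (finCongr (by simp)), P, Q, ?_⟩
  · simp [List.pairwise_append, List.pairwise_replicate]
  · rw [h]
    congr 1
    ext v
    rw [he v]
    simp [List.getElem_append]

/-- If `L` and `K` are equivalent to `diag a` and `diag b` by inverse changes of bases, and
`L * H + H' * K = c`, then every ideal `(a i, b i)` contains `c`. -/
theorem exists_combination_of_homotopy {R : Type*} [CommRing R] {L K H H' : Matrix V V R} {c : R}
    (hH : L * H + H' * K = c • 1) (P Q : (Matrix V V R)ˣ) {a b : V → R}
    (ha : (P : Matrix V V R) * L * (Q : Matrix V V R) = diagonal a)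
    (hb : ((Q⁻¹ : (Matrix V V R)ˣ) : Matrix V V R) * K * ((P⁻¹ : (Matrix V V R)ˣ) : Matrix V V R) =
      diagonal b) (v : V) :
    ∃ x y, a v * x + y * b v = c := by
  have key : diagonal a * (((Q⁻¹ : (Matrix V V R)ˣ) : Matrix V V R) * H *
      ((P⁻¹ : (Matrix V V R)ˣ) : Matrix V V R)) + ((P : Matrix V V R) * H' * Q) * diagonal b =
      c • 1 := by
    calc _ = (P : Matrix V V R) * (L * ((Q : Matrix V V R) * ((Q⁻¹ : (Matrix V V R)ˣ) : Matrix V V R)) * H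
          + H' * ((Q : Matrix V V R) * ((Q⁻¹ : (Matrix V V R)ˣ) : Matrix V V R)) * K) *
            ((P⁻¹ : (Matrix V V R)ˣ) : Matrix V V R) := by
            rw [← ha, ← hb]; noncomm_ring
      _ = c • 1 := by
        rw [Units.mul_inv, mul_one, mul_one, hH, mul_smul_comm, mul_one, smul_mul_assoc,
          Units.mul_inv]
  have := congrFun (congrFun key v) v
  rw [Matrix.add_apply, diagonal_mul, mul_diagonal] at this
  simp only [Matrix.smul_apply, one_apply_eq, smul_eq_mul, mul_one] at this
  exact ⟨_, _, this⟩

/-- The homotopy over `ℤ` bounds the common divisors of `a v` and `d / a v` by `2`, the one modulo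
`2` rules out `2` itself, and the equality of determinants fixes the product of the `a v`. -/
theorem hasInvariantFactors_of_homotopies {L K : Matrix V V ℤ} {d m : ℕ} (hd : d ≠ 0)
    (hcard : Fintype.card V = m + m) (hLK : L * K = (d : ℤ) • 1)
    (hdet : L.det = K.det)
    (hZ : ∃ H H' : Matrix V V ℤ, L * H + H' * K = (-2 : ℤ) • 1)
    (h2 : ∃ H H' : Matrix V V (ZMod 2), L.map (Int.cast : ℤ → ZMod 2) * H +
      H' * K.map (Int.cast : ℤ → ZMod 2) = 1) :
    HasInvariantFactors L (List.replicate m 1 ++ List.replicate m d) := by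
  obtain ⟨P, Q, a, h, hdvd, htot⟩ := exists_diagonal_dvd_total L K hd hLK
  have hpos (v) : 0 < a v := Nat.pos_of_dvd_of_pos (hdvd v) (Nat.pos_of_ne_zero hd)
  have hab (v) : (a v : ℤ) * (d / a v : ℕ) = d := by exact_mod_cast Nat.mul_div_cancel' (hdvd v)
  -- The product of `diag a` with this matrix is the scalar `d`, and the entries `a v` can be
  -- cancelled.
  have hK : ((Q⁻¹ : (Matrix V V ℤ)ˣ) : Matrix V V ℤ) * K * ((P⁻¹ : (Matrix V V ℤ)ˣ) : Matrix V V ℤ) =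
      diagonal fun v => ((d / a v : ℕ) : ℤ) := by
    have h1 : (diagonal fun v => (a v : ℤ)) *
        (((Q⁻¹ : (Matrix V V ℤ)ˣ) : Matrix V V ℤ) * K * ((P⁻¹ : (Matrix V V ℤ)ˣ) : Matrix V V ℤ)) =
        (d : ℤ) • 1 := by
      rw [← h]
      calc _ = (P : Matrix V V ℤ) * (L * ((Q : Matrix V V ℤ) *
            ((Q⁻¹ : (Matrix V V ℤ)ˣ) : Matrix V V ℤ)) * K) *
            ((P⁻¹ : (Matrix V V ℤ)ˣ) : Matrix V V ℤ) := by noncomm_ring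
        _ = (d : ℤ) • 1 := by
          rw [Units.mul_inv, mul_one, hLK, mul_smul_comm, mul_one, smul_mul_assoc, Units.mul_inv]
    ext v w
    have h3 := congrFun (congrFun h1 v) w
    rw [diagonal_mul] at h3
    have hav : (a v : ℤ) ≠ 0 := by exact_mod_cast (hpos v).ne'
    apply mul_left_cancel₀ hav
    rw [h3]
    by_cases hvw : v = w
    · subst hvw
      rw [diagonal_apply_eq, hab, Matrix.smul_apply, one_apply_eq, smul_eq_mul, mul_one]
    · simp [hvw]
  have hcop (v) : (a v).Coprime (d / a v) := by
    rw [Nat.coprime_iff_gcd_eq_one]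
    obtain ⟨H, H', hH⟩ := hZ
    obtain ⟨x, y, hxy⟩ := exists_combination_of_homotopy hH P Q h hK v
    have hg2 : (a v).gcd (d / a v) ∣ 2 := by
      have : (((a v).gcd (d / a v) : ℕ) : ℤ) ∣ -2 := by
        rw [← hxy]
        exact dvd_add ((Int.natCast_dvd_natCast.2 (Nat.gcd_dvd_left _ _)).mul_right _)
          ((Int.natCast_dvd_natCast.2 (Nat.gcd_dvd_right _ _)).mul_left _)
      rw [dvd_neg] at this
      exact_mod_cast this
    rcases (Nat.dvd_prime Nat.prime_two).1 hg2 with hg | hg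
    · exact hg
    exfalso
    obtain ⟨H, H', hH⟩ := h2
    let φ := (Int.castRingHom (ZMod 2)).mapMatrix (m := V)
    have ha2 := congrArg φ h
    have hb2 := congrArg φ hK
    rw [map_mul, map_mul] at ha2 hb2
    obtain ⟨x, y, hxy⟩ := exists_combination_of_homotopy (L := φ L) (K := φ K) (c := 1)
      (a := fun v => (a v : ZMod 2)) (b := fun v => ((d / a v : ℕ) : ZMod 2))
      (by rw [one_smul]; exact hH) (Units.map φ.toMonoidHom P) (Units.map φ.toMonoidHom Q)
      (by refine Eq.trans ha2 ?_
          simp [φ, diagonal_map])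
      (by refine Eq.trans hb2 ?_
          simp [φ, diagonal_map, -Nat.cast_div, -Int.natCast_ediv]) v
    have e1 : (a v : ZMod 2) = 0 := (ZMod.natCast_eq_zero_iff _ _).2 (hg ▸ Nat.gcd_dvd_left _ _)
    have e2 : ((d / a v : ℕ) : ZMod 2) = 0 :=
      (ZMod.natCast_eq_zero_iff _ _).2 (hg ▸ Nat.gcd_dvd_right _ _)
    rw [e1, e2, zero_mul, mul_zero, add_zero] at hxy
    exact zero_ne_one hxy
  have hprod : ∏ v, a v = d ^ m := by
    -- Squares are compared because the determinants of `P` and `Q` are known only up to sign.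
    have hdL : L.det * L.det = ((d : ℤ) ^ m) ^ 2 := by
      have := congrArg det hLK
      rw [det_mul, ← hdet, det_smul, det_one, mul_one, hcard] at this
      rw [this]; ring
    have hdP : ((P : Matrix V V ℤ).det) ^ 2 = 1 := by
      have : IsUnit (P : Matrix V V ℤ).det := (isUnit_iff_isUnit_det _).1 P.isUnit
      rcases Int.isUnit_iff.1 this with h | h <;> simp [h]
    have hdQ : ((Q : Matrix V V ℤ).det) ^ 2 = 1 := by
      have : IsUnit (Q : Matrix V V ℤ).det := (isUnit_iff_isUnit_det _).1 Q.isUnit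
      rcases Int.isUnit_iff.1 this with h | h <;> simp [h]
    have h4 := congrArg det h
    rw [det_mul, det_mul, det_diagonal] at h4
    have h5 : ((∏ v, a v : ℕ) : ℤ) ^ 2 = ((d ^ m : ℕ) : ℤ) ^ 2 := by
      push_cast
      rw [← h4, ← hdL, mul_pow, mul_pow, hdP, hdQ]; ring
    have h6 : (∏ v, a v) ^ 2 = (d ^ m) ^ 2 := by exact_mod_cast h5
    exact Nat.pow_left_injective (n := 2) (by norm_num) h6
  obtain ⟨e, he⟩ := exists_enumeration_of_unitary_divisors hd hcard a hdvd hcop htot hprod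
  exact hasInvariantFactors_of_diagonal P Q a h e he

end MatrixTheory

/-! ### Neighbors along a color, and signs around bicolor cycles. -/

namespace Adinkra

open Matrix

variable {N : ℕ} {V : Type*} [Fintype V]

theorem color_swap (A : Adinkra N V) {v w : V} (h : A.graph.Adj v w) :
    A.color ⟨s(w, v), h.symm⟩ = A.color ⟨s(v, w), h⟩ :=
  congrArg A.color (Subtype.ext Sym2.eq_swap)

theorem exists_neighbor (A : Adinkra N V) (i : Fin N) (v : V) :
    ∃ w, (∃ h : A.graph.Adj v w, A.color ⟨s(v, w), h⟩ = i) ∧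
      ∀ w' (h : A.graph.Adj v w'), A.color ⟨s(v, w'), h⟩ = i → w' = w := by
  obtain ⟨⟨e, he⟩, ⟨hv, hc⟩, huniq⟩ := A.existsUnique_edge v i
  obtain ⟨w, rfl⟩ := hv
  refine ⟨w, ⟨he, hc⟩, fun w' h hc' => ?_⟩
  have := congrArg Subtype.val (huniq ⟨s(v, w'), h⟩ ⟨Sym2.mem_mk_left _ _, hc'⟩)
  exact Sym2.congr_right.1 this

/-- The neighbor of a vertex along the edge of color `i`. -/
noncomputable def neighbor (A : Adinkra N V) (i : Fin N) (v : V) : V :=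
  (A.exists_neighbor i v).choose

theorem adj_neighbor (A : Adinkra N V) (i : Fin N) (v : V) : A.graph.Adj v (A.neighbor i v) :=
  (A.exists_neighbor i v).choose_spec.1.1

theorem color_neighbor (A : Adinkra N V) (i : Fin N) (v : V) :
    A.color ⟨s(v, A.neighbor i v), A.adj_neighbor i v⟩ = i :=
  (A.exists_neighbor i v).choose_spec.1.2

theorem neighbor_color (A : Adinkra N V) {v w : V} (h : A.graph.Adj v w) :
    A.neighbor (A.color ⟨s(v, w), h⟩) v = w :=
  ((A.exists_neighbor _ v).choose_spec.2 w h rfl).symm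

theorem neighbor_neighbor (A : Adinkra N V) (i : Fin N) (v : V) :
    A.neighbor i (A.neighbor i v) = v := by
  have := A.neighbor_color (A.adj_neighbor i v).symm
  rwa [A.color_swap (A.adj_neighbor i v), A.color_neighbor] at this

theorem eq_of_neighbor_eq (A : Adinkra N V) {i j : Fin N} {v : V}
    (h : A.neighbor i v = A.neighbor j v) : i = j := by
  rw [← A.color_neighbor i v, ← A.color_neighbor j v]
  congr 2
  rw [h]

open Classical in
/-- The sign of an edge, as an integer, and `0` for a pair of vertices that are not adjacent. -/
noncomputable def signOf (A : Adinkra N V) (v w : V) : ℤ :=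
  if h : A.graph.Adj v w then A.sign ⟨s(v, w), h⟩ else 0

theorem signOf_of_adj (A : Adinkra N V) {v w : V} (h : A.graph.Adj v w) :
    A.signOf v w = A.sign ⟨s(v, w), h⟩ := dif_pos h

theorem signOf_comm (A : Adinkra N V) (v w : V) : A.signOf v w = A.signOf w v := by
  by_cases h : A.graph.Adj v w
  · rw [A.signOf_of_adj h, A.signOf_of_adj h.symm]
    congr 3
    exact Sym2.eq_swap
  · rw [signOf, signOf, dif_neg h, dif_neg fun h' => h h'.symm]

theorem signOf_mul_self (A : Adinkra N V) {v w : V} (h : A.graph.Adj v w) :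
    A.signOf v w * A.signOf v w = 1 := by
  rw [A.signOf_of_adj h, ← Units.val_mul, Int.units_mul_self, Units.val_one]

theorem neighbor_mem_supp (A : Adinkra N V) {i j k : Fin N} (hk : k = i ∨ k = j)
    (c : (bicolorGraph A.graph A.color i j).ConnectedComponent) {v : V} (hv : v ∈ c.supp) :
    A.neighbor k v ∈ c.supp := by
  refine c.mem_supp_of_adj_mem_supp hv ?_
  rw [bicolorGraph, SimpleGraph.fromEdgeSet_adj]
  refine ⟨⟨A.adj_neighbor k v, ?_⟩, (A.adj_neighbor k v).ne⟩
  rwa [A.color_neighbor]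

theorem neighbor_neighbor_ne (A : Adinkra N V) {i j : Fin N} (hij : i ≠ j) (v : V) :
    A.neighbor j (A.neighbor i v) ≠ v := by
  intro h
  have h2 : A.neighbor j (A.neighbor i v) = A.neighbor i (A.neighbor i v) := by
    rw [h, neighbor_neighbor]
  exact hij (A.eq_of_neighbor_eq h2).symm

theorem neighbor_neighbor_ne_neighbor (A : Adinkra N V) {i j : Fin N} (v : V) :
    A.neighbor j (A.neighbor i v) ≠ A.neighbor j v := by
  intro h
  have := congrArg (A.neighbor j) h
  rw [neighbor_neighbor, neighbor_neighbor] at this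
  exact (A.adj_neighbor i v).ne this.symm

/-- The four listed vertices are distinct and lie in the component, which has only four vertices. -/
theorem supp_eq (A : Adinkra N V) {i j : Fin N} (hij : i ≠ j) (v : V)
    (c : (bicolorGraph A.graph A.color i j).ConnectedComponent) (hv : v ∈ c.supp) :
    c.supp = {v, A.neighbor i v, A.neighbor j v, A.neighbor j (A.neighbor i v)} := by
  classical
  obtain ⟨e⟩ := A.bicolor_cycle i j hij c
  have hcard : c.supp.ncard = 4 := by
    rw [← Nat.card_coe_set_eq]
    exact (Nat.card_congr e.toEquiv).trans (Nat.card_fin 4)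
  have hi := A.neighbor_mem_supp (Or.inl rfl) c hv
  have hsub : ({v, A.neighbor i v, A.neighbor j v, A.neighbor j (A.neighbor i v)} : Finset V).card
      = 4 := by
    rw [Finset.card_eq_succ]
    refine ⟨v, {A.neighbor i v, A.neighbor j v, A.neighbor j (A.neighbor i v)}, ?_, rfl, ?_⟩
    · simp only [Finset.mem_insert, Finset.mem_singleton, not_or]
      exact ⟨(A.adj_neighbor i v).ne, (A.adj_neighbor j v).ne, (A.neighbor_neighbor_ne hij v).symm⟩
    · rw [Finset.card_eq_three]
      exact ⟨_, _, _, fun h => hij (A.eq_of_neighbor_eq h), (A.adj_neighbor j _).ne,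
        (A.neighbor_neighbor_ne_neighbor v).symm, rfl⟩
  symm
  refine Set.eq_of_subset_of_ncard_le ?_ ?_ (Set.toFinite _)
  · rintro x (rfl | rfl | rfl | rfl)
    exacts [hv, hi, A.neighbor_mem_supp (Or.inr rfl) c hv, A.neighbor_mem_supp (Or.inr rfl) c hi]
  · rw [hcard, ← hsub, ← Set.ncard_coe_finset]
    simp

theorem neighbor_comm (A : Adinkra N V) {i j : Fin N} (hij : i ≠ j) (v : V) :
    A.neighbor i (A.neighbor j v) = A.neighbor j (A.neighbor i v) := by
  let c := (bicolorGraph A.graph A.color i j).connectedComponentMk v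
  have hv : v ∈ c.supp := rfl
  have h := A.neighbor_mem_supp (i := i) (j := j) (Or.inl rfl) c
    (A.neighbor_mem_supp (Or.inr rfl) c hv)
  rw [A.supp_eq hij v c hv] at h
  rcases h with h | h | h | h
  · exact absurd h (A.neighbor_neighbor_ne hij.symm v)
  · exact absurd h (A.neighbor_neighbor_ne_neighbor v)
  · exact absurd h (A.adj_neighbor i _).ne'
  · exact h

theorem prod_eq_neg_one_of_odd_card {ι : Type*} [Fintype ι] [DecidableEq ι] (f : ι → ℤˣ)
    (h : Odd (Finset.univ.filter fun k => f k = -1).card) : ∏ k, f k = -1 := by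
  have hf (k) : f k = if f k = -1 then -1 else 1 := by
    rcases Int.units_eq_one_or (f k) with h | h <;> simp [h]
  rw [Finset.prod_congr rfl fun k _ => hf k, Finset.prod_ite, Finset.prod_const, Finset.prod_const_one,
    mul_one, h.neg_one_pow]

omit [Fintype V] in
theorem square_edges_injective {v a b x : V} (hva : v ≠ a) (hvb : v ≠ b) (hax : a ≠ x)
    (hbx : b ≠ x) (hvx : v ≠ x) (hab : a ≠ b) :
    Function.Injective ![s(v, a), s(a, x), s(v, b), s(b, x)] := by
  intro k l h
  fin_cases k <;> fin_cases l <;> first | rfl | skip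
  all_goals
    exfalso
    simp [hva, hvb, hax, hbx, hvx, hab, hva.symm, hvb.symm, hax.symm, hbx.symm,
      hvx.symm, hab.symm] at h

/-- An odd number of dashed edges makes the product of the four signs `-1`, so the two paths of
length two from `v` to the opposite corner have opposite signs. This is the anticommutation of the
color matrices. -/
theorem signOf_cycle (A : Adinkra N V) {i j : Fin N} (hij : i ≠ j) (v : V) :
    A.signOf v (A.neighbor i v) * A.signOf (A.neighbor i v) (A.neighbor j (A.neighbor i v)) =
      -(A.signOf v (A.neighbor j v) *
        A.signOf (A.neighbor j v) (A.neighbor i (A.neighbor j v))) := by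
  classical
  let c := (bicolorGraph A.graph A.color i j).connectedComponentMk v
  have hv : v ∈ c.supp := rfl
  have hodd := A.totally_odd i j hij c
  have hsupp := A.supp_eq hij v c hv
  let E : Fin 4 → A.graph.edgeSet := ![⟨s(_, _), A.adj_neighbor i v⟩,
    ⟨s(_, _), A.adj_neighbor j (A.neighbor i v)⟩, ⟨s(_, _), A.adj_neighbor j v⟩,
    ⟨s(_, _), A.adj_neighbor i (A.neighbor j v)⟩]
  have hcomm := A.neighbor_comm hij v
  have hE : Function.Injective E := by
    have hval (k) : (E k).1 = ![s(v, A.neighbor i v),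
        s(A.neighbor i v, A.neighbor i (A.neighbor j v)), s(v, A.neighbor j v),
        s(A.neighbor j v, A.neighbor i (A.neighbor j v))] k := by
      fin_cases k
      · rfl
      · exact congrArg (fun x => s(A.neighbor i v, x)) hcomm.symm
      · rfl
      · rfl
    intro k l hkl
    refine square_edges_injective (A.adj_neighbor i v).ne (A.adj_neighbor j v).ne ?_
      (A.adj_neighbor i (A.neighbor j v)).ne (A.neighbor_neighbor_ne hij.symm v).symm
      (fun h => hij (A.eq_of_neighbor_eq h)) ((hval k).symm.trans ?_)
    · rw [hcomm]
      exact (A.adj_neighbor j (A.neighbor i v)).ne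
    · rw [hkl]
      exact hval l
  have hset : {e : A.graph.edgeSet | (∀ w ∈ e.1, w ∈ c.supp) ∧
      (A.color e = i ∨ A.color e = j) ∧ A.sign e = -1} =
      (Finset.univ.filter fun k => A.sign (E k) = -1).image E := by
    ext e
    simp only [Set.mem_ofPred_eq, Finset.coe_image, Finset.coe_filter, Finset.mem_univ, true_and,
      Set.mem_image]
    constructor
    · rintro ⟨h1, h2, h3⟩
      suffices ∃ k, E k = e by
        obtain ⟨k, rfl⟩ := this
        exact ⟨k, h3, rfl⟩
      obtain ⟨e, he⟩ := e
      induction e using Sym2.ind with | _ p q =>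
      have hp := h1 p (Sym2.mem_mk_left _ _)
      have hpq : A.graph.Adj p q := he
      have hq : q = A.neighbor i p ∨ q = A.neighbor j p := by
        rcases h2 with h2 | h2
        · left; rw [← h2, A.neighbor_color hpq]
        · right; rw [← h2, A.neighbor_color hpq]
      rw [hsupp] at hp
      have : s(p, q) = (E 0).1 ∨ s(p, q) = (E 1).1 ∨ s(p, q) = (E 2).1 ∨ s(p, q) = (E 3).1 := by
        clear h1 h2 he hpq h3
        rcases hp with rfl | rfl | rfl | rfl <;> rcases hq with rfl | rfl
        · exact Or.inl rfl
        · exact Or.inr (Or.inr (Or.inl rfl))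
        · rw [A.neighbor_neighbor]
          exact Or.inl Sym2.eq_swap
        · exact Or.inr (Or.inl rfl)
        · exact Or.inr (Or.inr (Or.inr rfl))
        · rw [A.neighbor_neighbor]
          exact Or.inr (Or.inr (Or.inl Sym2.eq_swap))
        · rw [← hcomm, A.neighbor_neighbor]
          exact Or.inr (Or.inr (Or.inr Sym2.eq_swap))
        · rw [A.neighbor_neighbor]
          exact Or.inr (Or.inl Sym2.eq_swap)
      rcases this with h | h | h | h
      exacts [⟨0, Subtype.ext h.symm⟩, ⟨1, Subtype.ext h.symm⟩, ⟨2, Subtype.ext h.symm⟩,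
        ⟨3, Subtype.ext h.symm⟩]
    · rintro ⟨k, hk, rfl⟩
      refine ⟨?_, ?_, hk⟩
      · have ha := A.neighbor_mem_supp (Or.inl rfl) c hv
        have hb := A.neighbor_mem_supp (Or.inr rfl) c hv
        have hx := A.neighbor_mem_supp (Or.inr rfl) c ha
        have hx' := A.neighbor_mem_supp (Or.inl rfl) c hb
        fin_cases k <;> intro w hw <;> rcases Sym2.mem_iff.1 hw with rfl | rfl <;> assumption
      · fin_cases k
        exacts [Or.inl (A.color_neighbor i _), Or.inr (A.color_neighbor j _),
          Or.inr (A.color_neighbor j _), Or.inl (A.color_neighbor i _)]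
  rw [hset, Set.ncard_coe_finset, Finset.card_image_of_injective _ hE] at hodd
  have hprod := prod_eq_neg_one_of_odd_card (fun k => A.sign (E k)) hodd
  rw [Fin.prod_univ_four] at hprod
  have hp := congrArg (Units.val) hprod
  simp only [Units.val_mul] at hp
  have h0 : A.signOf v (A.neighbor i v) = A.sign (E 0) := A.signOf_of_adj _
  have h1 : A.signOf (A.neighbor i v) (A.neighbor j (A.neighbor i v)) = A.sign (E 1) :=
    A.signOf_of_adj _
  have h2 : A.signOf v (A.neighbor j v) = A.sign (E 2) := A.signOf_of_adj _
  have h3 : A.signOf (A.neighbor j v) (A.neighbor i (A.neighbor j v)) = A.sign (E 3) :=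
    A.signOf_of_adj _
  have hs2 := A.signOf_mul_self (A.adj_neighbor j v)
  have hs3 := A.signOf_mul_self (A.adj_neighbor i (A.neighbor j v))
  rw [← h0, ← h1, ← h2, ← h3, Units.val_neg, Units.val_one] at hp
  generalize A.signOf v (A.neighbor i v) = s0 at *
  generalize A.signOf (A.neighbor i v) (A.neighbor j (A.neighbor i v)) = s1 at *
  generalize A.signOf v (A.neighbor j v) = s2 at *
  generalize A.signOf (A.neighbor j v) (A.neighbor i (A.neighbor j v)) = s3 at *
  linear_combination (s2 * s3) * hp - s0 * s1 * s3 * s3 * hs2 - s0 * s1 * hs3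

theorem exists_alternating_sign (A : Adinkra N V) :
    ∃ ε : V → ℤ, (∀ v, ε v = 1 ∨ ε v = -1) ∧ ∀ v w, A.graph.Adj v w → ε w = -ε v := by
  obtain ⟨c⟩ := A.bipartite
  refine ⟨fun v => if c v = 0 then 1 else -1, fun v => by dsimp only; split_ifs <;> simp, fun v w h => ?_⟩
  have := c.valid h
  dsimp only
  split_ifs <;> first | rfl | omega

/-! ### Color matrices, their Clifford relations, and the integral homotopy. -/

section
variable [DecidableEq V]

/-- The signed adjacency matrix of the edges of color `i`. -/
noncomputable def colorMatrix (A : Adinkra N V) (i : Fin N) : Matrix V V ℤ :=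
  of fun v w => if w = A.neighbor i v then A.signOf v w else 0

theorem sum_colorMatrix_apply (A : Adinkra N V) (v w : V) :
    (∑ i, A.colorMatrix i) v w = A.signOf v w := by
  rw [Matrix.sum_apply]
  simp only [colorMatrix, of_apply]
  by_cases h : A.graph.Adj v w
  · rw [Finset.sum_eq_single (A.color ⟨s(v, w), h⟩), if_pos (A.neighbor_color h).symm]
    · rintro i - hi
      rw [if_neg]
      rintro rfl
      exact hi (A.color_neighbor i v).symm
    · simp
  · rw [signOf, dif_neg h]
    simp

theorem degree_eq (A : Adinkra N V) (v : V) [Fintype (A.graph.neighborSet v)] :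
    A.graph.degree v = N := by
  have : A.graph.neighborFinset v = Finset.univ.image fun i => A.neighbor i v := by
    ext w
    simp only [SimpleGraph.mem_neighborFinset, Finset.mem_image, Finset.mem_univ, true_and]
    constructor
    · exact fun h => ⟨_, A.neighbor_color h⟩
    · rintro ⟨i, rfl⟩
      exact A.adj_neighbor i v
  rw [← SimpleGraph.card_neighborFinset_eq_degree, this, Finset.card_image_of_injective _
    fun i j h => A.eq_of_neighbor_eq h, Finset.card_fin]

theorem signedLaplacian_eq (A : Adinkra N V) :
    A.signedLaplacian = (N : ℤ) • 1 - ∑ i, A.colorMatrix i := by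
  ext v w
  rw [Matrix.sub_apply, sum_colorMatrix_apply, Matrix.smul_apply, SignedGraph.signedLaplacian,
    of_apply]
  by_cases hvw : v = w
  · subst hvw
    rw [if_pos rfl, A.degree_eq, signOf, dif_neg (A.graph.loopless.irrefl v)]
    simp
  · rw [if_neg hvw, Matrix.one_apply_ne hvw, signOf]
    split_ifs <;> simp

theorem colorMatrix_mul_apply (A : Adinkra N V) (i j : Fin N) (v w : V) :
    (A.colorMatrix i * A.colorMatrix j) v w =
      if w = A.neighbor j (A.neighbor i v) then
        A.signOf v (A.neighbor i v) * A.signOf (A.neighbor i v) (A.neighbor j (A.neighbor i v))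
      else 0 := by
  rw [Matrix.mul_apply, Finset.sum_eq_single (A.neighbor i v)]
  · simp only [colorMatrix, of_apply, if_true]
    split_ifs with h
    · rw [h]
    · rw [mul_zero]
  · intro x _ hx
    rw [colorMatrix, of_apply, if_neg hx, zero_mul]
  · simp

theorem colorMatrix_mul_self (A : Adinkra N V) (i : Fin N) :
    A.colorMatrix i * A.colorMatrix i = 1 := by
  ext v w
  rw [colorMatrix_mul_apply, neighbor_neighbor, A.signOf_comm (A.neighbor i v) v,
    A.signOf_mul_self (A.adj_neighbor i v), one_apply]
  exact if_congr eq_comm rfl rfl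

theorem colorMatrix_mul_add_mul (A : Adinkra N V) {i j : Fin N} (hij : i ≠ j) :
    A.colorMatrix i * A.colorMatrix j + A.colorMatrix j * A.colorMatrix i = 0 := by
  ext v w
  rw [Matrix.add_apply, colorMatrix_mul_apply, colorMatrix_mul_apply, A.signOf_cycle hij,
    A.neighbor_comm hij]
  split_ifs <;> simp

theorem colorMatrix_mul_sum_add_sum_mul (A : Adinkra N V) (i : Fin N) :
    A.colorMatrix i * (∑ j, A.colorMatrix j) + (∑ j, A.colorMatrix j) * A.colorMatrix i =
      (2 : ℤ) • 1 := by
  rw [Finset.mul_sum, Finset.sum_mul, ← Finset.sum_add_distrib, Finset.sum_eq_single i,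
    colorMatrix_mul_self, two_smul]
  · exact fun j _ hj => A.colorMatrix_mul_add_mul hj.symm
  · simp

theorem sum_colorMatrix_mul_self (A : Adinkra N V) :
    (∑ i, A.colorMatrix i) * (∑ i, A.colorMatrix i) = (N : ℤ) • 1 := by
  have h : (∑ i, A.colorMatrix i) * (∑ i, A.colorMatrix i) +
      (∑ i, A.colorMatrix i) * (∑ i, A.colorMatrix i) = (N : ℤ) • (2 : ℤ) • 1 := by
    calc _ = ∑ i, (A.colorMatrix i * (∑ j, A.colorMatrix j) +
          (∑ j, A.colorMatrix j) * A.colorMatrix i) := by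
            rw [Finset.sum_add_distrib, ← Finset.sum_mul, ← Finset.mul_sum]
      _ = _ := by
        simp [colorMatrix_mul_sum_add_sum_mul]
  apply smul_right_injective _ (two_ne_zero' ℤ)
  simp only
  rw [two_smul, h, smul_comm]

theorem laplacian_mul (A : Adinkra N V) :
    ((N : ℤ) • 1 - ∑ i, A.colorMatrix i) * ((N : ℤ) • 1 + ∑ i, A.colorMatrix i) =
      ((N ^ 2 - N : ℕ) : ℤ) • 1 := by
  rw [Nat.cast_sub (Nat.le_self_pow two_ne_zero N), Nat.cast_pow, sub_smul]
  have h := A.sum_colorMatrix_mul_self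
  revert h
  generalize ∑ i, A.colorMatrix i = S
  intro h
  simp only [sub_mul, mul_add, smul_mul_assoc, mul_smul_comm, one_mul, mul_one, h]
  module

/-- For a color matrix `D`, the terms in `N` cancel in `(N - S) * D - D * (N + S)`, which leaves
`-(S * D + D * S) = -2`. -/
theorem laplacian_homotopy (A : Adinkra N V) :
    ∃ H H' : Matrix V V ℤ, ((N : ℤ) • 1 - ∑ i, A.colorMatrix i) * H +
      H' * ((N : ℤ) • 1 + ∑ i, A.colorMatrix i) = (-2 : ℤ) • 1 := by
  let i : Fin N := ⟨0, A.one_le⟩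
  refine ⟨A.colorMatrix i, -A.colorMatrix i, ?_⟩
  rw [neg_smul, ← A.colorMatrix_mul_sum_add_sum_mul i]
  generalize ∑ i, A.colorMatrix i = S
  simp only [sub_mul, neg_mul, mul_add, smul_mul_assoc, mul_smul_comm, one_mul, mul_one]
  module

theorem diagonal_mul_sum_colorMatrix (A : Adinkra N V) {ε : V → ℤ}
    (hadj : ∀ v w, A.graph.Adj v w → ε w = -ε v) :
    diagonal ε * (∑ i, A.colorMatrix i) = -((∑ i, A.colorMatrix i) * diagonal ε) := by
  ext v w
  rw [diagonal_mul, Matrix.neg_apply, mul_diagonal, sum_colorMatrix_apply]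
  by_cases h : A.graph.Adj v w
  · rw [hadj v w h]; ring
  · rw [signOf, dif_neg h]; simp

/-- The signs of the bipartition form a diagonal involution that anticommutes with `S`, so it
conjugates `N - S` to `N + S`. -/
theorem det_laplacian (A : Adinkra N V) :
    ((N : ℤ) • 1 - ∑ i, A.colorMatrix i).det = ((N : ℤ) • 1 + ∑ i, A.colorMatrix i).det := by
  obtain ⟨ε, hε, hadj⟩ := A.exists_alternating_sign
  have hsq : diagonal ε * diagonal ε = 1 := by
    rw [diagonal_mul_diagonal, ← diagonal_one]
    congr 1
    ext v
    rcases hε v with h | h <;> simp [h]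
  have h1 : diagonal ε * ((N : ℤ) • 1 - ∑ i, A.colorMatrix i) =
      ((N : ℤ) • 1 + ∑ i, A.colorMatrix i) * diagonal ε := by
    rw [mul_sub, A.diagonal_mul_sum_colorMatrix hadj, add_mul, mul_smul_comm, smul_mul_assoc,
      mul_one, one_mul, sub_neg_eq_add]
  have h2 := congrArg det h1
  have h3 := congrArg det hsq
  rw [det_mul, det_mul] at h2
  rw [det_mul, det_one] at h3
  linear_combination (diagonal ε).det * h2 + (((N : ℤ) • 1 + ∑ i, A.colorMatrix i).det -
    ((N : ℤ) • 1 - ∑ i, A.colorMatrix i).det) * h3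

omit [DecidableEq V] in
theorem card_filter_eq_card_filter (A : Adinkra N V) {ε : V → ℤ}
    (hadj : ∀ v w, A.graph.Adj v w → ε w = -ε v) :
    (Finset.univ.filter fun v => ε v = 1).card = (Finset.univ.filter fun v => ε v = -1).card := by
  let i : Fin N := ⟨0, A.one_le⟩
  refine Finset.card_bij' (fun v _ => A.neighbor i v) (fun v _ => A.neighbor i v) ?_ ?_
    (fun v _ => A.neighbor_neighbor i v) (fun v _ => A.neighbor_neighbor i v)
  all_goals
    intro v hv
    simp only [Finset.mem_filter, Finset.mem_univ, true_and] at hv ⊢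
    rw [hadj _ _ (A.adj_neighbor i v), hv]
  rw [neg_neg]

omit [DecidableEq V] in
theorem card_eq (A : Adinkra N V) : Fintype.card V = Fintype.card V / 2 + Fintype.card V / 2 := by
  obtain ⟨ε, hε, hadj⟩ := A.exists_alternating_sign
  have h := A.card_filter_eq_card_filter hadj
  have h2 := Finset.card_filter_add_card_filter_not (s := (Finset.univ : Finset V))
    (fun v => ε v = 1)
  have h3 : (Finset.univ.filter fun v => ¬ ε v = 1) = Finset.univ.filter fun v => ε v = -1 := by
    ext v
    rcases hε v with h | h <;> simp [h]
  rw [h3, ← h, Finset.card_univ] at h2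
  omega

end

end Adinkra

/-! ### The quotient of the cube as a Cayley graph, and homotopies modulo `2`. -/

section CubeQuotient

open Matrix

variable {N : ℕ}

theorem sum_mul_self_of_add_self_eq_zero {R ι : Type*} [Ring R] (hR : ∀ r : R, r + r = 0)
    (x : ι → R) (hx : ∀ i j, x i * x j = x j * x i) (s : Finset ι) :
    (∑ i ∈ s, x i) * (∑ i ∈ s, x i) = ∑ i ∈ s, x i * x i := by
  classical
  induction s using Finset.induction_on with
  | empty => simp
  | insert i s hi ih =>
    have hcomm : (∑ j ∈ s, x j) * x i = x i * ∑ j ∈ s, x j := by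
      rw [Finset.sum_mul, Finset.mul_sum]
      exact Finset.sum_congr rfl fun j _ => hx j i
    rw [Finset.sum_insert hi, Finset.sum_insert hi, add_mul, mul_add, mul_add, ih, hcomm,
      add_assoc, ← add_assoc (x i * ∑ j ∈ s, x j), hR, zero_add]

theorem cubeGraph_adj_iff (v w : Fin N → ZMod 2) :
    (cubeGraph N).Adj v w ↔ ∃ i, w = v + Pi.single i 1 := by
  change hammingDist v w = 1 ↔ _
  rw [hammingDist, Finset.card_eq_one]
  refine exists_congr fun i => ?_
  have h2 : ∀ a b : ZMod 2, a ≠ b ↔ b = a + 1 := by decide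
  constructor
  · intro h
    ext j
    have hj := Finset.ext_iff.1 h j
    simp only [Finset.mem_filter, Finset.mem_univ, true_and, Finset.mem_singleton] at hj
    by_cases hij : j = i
    · subst hij
      simpa using (h2 _ _).1 (hj.2 rfl)
    · rw [Pi.add_apply, Pi.single_eq_of_ne hij, add_zero]
      by_contra hne
      exact hij (hj.1 (Ne.symm hne))
  · rintro rfl
    ext j
    by_cases hij : j = i
    · subst hij; simp
    · simp [hij]

/-- The class of the `i`-th standard basis vector in the quotient by `C`. -/
def basisClass (C : Submodule (ZMod 2) (Fin N → ZMod 2)) (i : Fin N) : (Fin N → ZMod 2) ⧸ C :=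
  C.mkQ (Pi.single i 1)

variable {C : Submodule (ZMod 2) (Fin N → ZMod 2)}

theorem basisClass_add_self (i : Fin N) : basisClass C i + basisClass C i = 0 :=
  ZModModule.add_self _

theorem basisClass_ne_zero (hC : IsDoublyEven C) (i : Fin N) : basisClass C i ≠ 0 := by
  intro h
  have hmem := (Submodule.Quotient.mk_eq_zero C).1 h
  have h4 := hC _ hmem
  have : hammingNorm (Pi.single i 1 : Fin N → ZMod 2) = 1 := by
    rw [hammingNorm, Finset.card_eq_one]
    refine ⟨i, ?_⟩
    ext j
    by_cases hij : j = i
    · subst hij; simp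
    · simp [hij]
  omega

/-- Two coordinates with the same class would give a codeword of weight `2`. Injectivity ensures
that each edge of the quotient comes from exactly one generator. -/
theorem basisClass_injective (hC : IsDoublyEven C) : Function.Injective (basisClass C) := by
  intro i j h
  by_contra hij
  have h4 := hC _ ((Submodule.Quotient.eq C).1 h)
  have : hammingNorm (Pi.single i 1 - Pi.single j 1 : Fin N → ZMod 2) = 2 := by
    rw [hammingNorm, Finset.card_eq_two]
    refine ⟨i, j, hij, ?_⟩
    ext k
    by_cases hki : k = i
    · subst hki; simp [hij]
    · by_cases hkj : k = j
      · subst hkj; simp [hki]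
      · simp [hki, hkj]
  omega

theorem cubeQuotient_adj_iff (hC : IsDoublyEven C) (a b : (Fin N → ZMod 2) ⧸ C) :
    (cubeQuotient C).Adj a b ↔ ∃ i, b = a + basisClass C i := by
  have key (a b : (Fin N → ZMod 2) ⧸ C) :
      (∃ v w, C.mkQ v = a ∧ C.mkQ w = b ∧ (cubeGraph N).Adj v w) ↔
        ∃ i, b = a + basisClass C i := by
    simp only [cubeGraph_adj_iff]
    constructor
    · rintro ⟨v, w, rfl, rfl, i, rfl⟩
      exact ⟨i, map_add _ _ _⟩
    · rintro ⟨i, rfl⟩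
      obtain ⟨v, rfl⟩ := C.mkQ_surjective a
      exact ⟨v, _, rfl, map_add _ _ _, i, rfl⟩
  rw [cubeQuotient, SimpleGraph.fromRel_adj, key, key]
  constructor
  · rintro ⟨-, h | ⟨i, hi⟩⟩
    · exact h
    · exact ⟨i, by rw [hi, add_assoc, basisClass_add_self, add_zero]⟩
  · rintro ⟨i, hi⟩
    exact ⟨fun h => basisClass_ne_zero hC i (by simpa [h] using hi), Or.inl ⟨i, hi⟩⟩

/-- If `C` does not contain the all-ones vector, then a linear functional on the quotient takes the
value `1` on an odd number of the classes of the basis vectors. -/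
theorem exists_functional_sum_eq_one (h_one : (fun _ => 1 : Fin N → ZMod 2) ∉ C) :
    ∃ f : ((Fin N → ZMod 2) ⧸ C) →ₗ[ZMod 2] ZMod 2, ∑ i, f (basisClass C i) = 1 := by
  obtain ⟨g, hg, hker⟩ := Submodule.exists_le_ker_of_notMem h_one
  refine ⟨C.liftQ g hker, ?_⟩
  have h1 : ∑ i, (Pi.single i 1 : Fin N → ZMod 2) = fun _ => 1 := by
    ext j
    simp [Finset.sum_apply, Pi.single_apply]
  simp only [basisClass, ← map_sum]
  rw [h1]
  have h2 : ∀ a : ZMod 2, a ≠ 0 → a = 1 := by decide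
  exact h2 _ hg

section Translation

variable {V : Type*} [Fintype V] [DecidableEq V] {Q : Type*} [AddCommGroup Q] [DecidableEq Q]

/-- The permutation matrix of the translation by `q`. -/
def translationMatrix (φ : V ≃ Q) (q : Q) : Matrix V V (ZMod 2) :=
  of fun v w => if φ w = φ v + q then 1 else 0

omit [DecidableEq V] in
theorem translationMatrix_mul (φ : V ≃ Q) (q r : Q) :
    translationMatrix φ q * translationMatrix φ r = translationMatrix φ (q + r) := by
  ext v w
  rw [Matrix.mul_apply, Finset.sum_eq_single (φ.symm (φ v + q))]
  · simp [translationMatrix, add_assoc]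
  · intro x _ hx
    rw [translationMatrix, of_apply, if_neg, zero_mul]
    intro h
    exact hx (by rw [← h, φ.symm_apply_apply])
  · simp

omit [Fintype V] in
theorem translationMatrix_zero (φ : V ≃ Q) : translationMatrix φ 0 = 1 := by
  ext v w
  rw [translationMatrix, of_apply, add_zero, one_apply]
  exact if_congr (φ.injective.eq_iff.trans eq_comm) rfl rfl

omit [Fintype V] [DecidableEq V] in
theorem matrix_add_self (M : Matrix V V (ZMod 2)) : M + M = 0 :=
  ZModModule.add_self M

/-- The reduction modulo `2` of the adjacency operator of a Cayley graph of an elementary abelian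
`2`-group is null-homotopic as soon as an additive character is `1` on an odd number of
generators. -/
theorem translation_homotopy (φ : V ≃ Q) {ι : Type*} [Fintype ι] (q : ι → Q)
    (hq : ∀ i, q i + q i = 0) (f : Q →+ ZMod 2) (hf : ∑ i, f (q i) = 1) (c : ZMod 2) :
    ∃ H H' : Matrix V V (ZMod 2), (c • 1 - ∑ i, translationMatrix φ (q i)) * H +
      H' * (c • 1 + ∑ i, translationMatrix φ (q i)) = 1 := by
  -- Multiplication by the additive function `f` acts as a derivation: its commutator with the
  -- translation by `q` is `f q` times that translation. Hence `B` is the commutator of `E` with the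
  -- adjacency operator.
  let E : Matrix V V (ZMod 2) := diagonal fun v => f (φ v)
  let B : Matrix V V (ZMod 2) := ∑ i, f (q i) • translationMatrix φ (q i)
  have hcomm (i j) : translationMatrix φ (q i) * translationMatrix φ (q j) =
      translationMatrix φ (q j) * translationMatrix φ (q i) := by
    rw [translationMatrix_mul, translationMatrix_mul, add_comm]
  -- The translations commute, so squaring is additive in characteristic `2`; each translation
  -- squares to `1`, and the coefficients sum to `1`.
  have hBB : B * B = 1 := by
    have hsq : ∀ a : ZMod 2, a * a = a := by decide
    have := sum_mul_self_of_add_self_eq_zero matrix_add_self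
      (fun i => f (q i) • translationMatrix φ (q i))
      (fun i j => by simp only [smul_mul_assoc, mul_smul_comm, hcomm i j, smul_comm (f (q i))])
      Finset.univ
    refine this.trans ?_
    simp only [smul_mul_assoc, mul_smul_comm, translationMatrix_mul, hq, translationMatrix_zero,
      smul_smul, hsq]
    rw [← Finset.sum_smul, hf, one_smul]
  have hBS : B * (∑ i, translationMatrix φ (q i)) = (∑ i, translationMatrix φ (q i)) * B := by
    simp only [B, Finset.sum_mul, Finset.mul_sum, smul_mul_assoc, mul_smul_comm]
    rw [Finset.sum_comm]
    refine Finset.sum_congr rfl fun j _ => ?_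
    rw [Finset.smul_sum]
    exact Finset.sum_congr rfl fun i _ => by rw [hcomm]
  have hES : E * (∑ i, translationMatrix φ (q i)) + (∑ i, translationMatrix φ (q i)) * E = B := by
    rw [Finset.sum_mul, Finset.mul_sum, ← Finset.sum_add_distrib]
    refine Finset.sum_congr rfl fun i _ => ?_
    ext v w
    rw [Matrix.add_apply, diagonal_mul, mul_diagonal, Matrix.smul_apply, translationMatrix,
      of_apply]
    split_ifs with h
    · rw [h, map_add, mul_one, one_mul, smul_eq_mul, mul_one, ← add_assoc, ZModModule.add_self,
        zero_add]
    · simp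
  -- As `B` commutes with the adjacency operator, the commutator of `E * B` with it is `B * B = 1`.
  -- The terms in `c` occur twice and vanish.
  refine ⟨E * B, E * B, ?_⟩
  generalize ∑ i, translationMatrix φ (q i) = S at *
  calc (c • 1 - S) * (E * B) + E * B * (c • 1 + S)
      = (c • (E * B) + c • (E * B)) - (S * E * B + S * E * B) + (E * S + S * E) * B
          + E * (B * S - S * B) := by
        simp only [sub_mul, mul_add, add_mul, mul_sub, smul_mul_assoc, mul_smul_comm, one_mul,
          mul_one, mul_assoc]
        abel
    _ = 1 := by
      rw [matrix_add_self, matrix_add_self, hES, hBB, hBS, sub_self, sub_self, zero_add, mul_zero,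
        add_zero]

end Translation

end CubeQuotient

/-! ### The homotopy modulo `2` for an Adinkra, and the case of one color. -/

namespace Adinkra

open Matrix

variable {N : ℕ} {V : Type*} [Fintype V] [DecidableEq V]

omit [DecidableEq V] in
theorem signOf_cast (A : Adinkra N V) [DecidableRel A.graph.Adj] (v w : V) :
    (A.signOf v w : ZMod 2) = if A.graph.Adj v w then 1 else 0 := by
  split_ifs with h
  · rw [A.signOf_of_adj h]
    rcases Int.units_eq_one_or (A.sign ⟨s(v, w), h⟩) with h | h <;> rw [h]
    · simp
    · decide
  · rw [signOf, dif_neg h, Int.cast_zero]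

/-- Modulo `2` the sum of the color matrices is the plain adjacency matrix, so a graph isomorphism
suffices: the colors need not correspond to the coordinates of the cube. -/
theorem laplacian_homotopy_mod_two (A : Adinkra N V)
    {C : Submodule (ZMod 2) (Fin N → ZMod 2)} (hC : IsDoublyEven C)
    (φ : A.graph ≃g cubeQuotient C) (h_one : (fun _ => 1 : Fin N → ZMod 2) ∉ C) :
    ∃ H H' : Matrix V V (ZMod 2),
      ((N : ℤ) • 1 - ∑ i, A.colorMatrix i).map (Int.cast : ℤ → ZMod 2) * H +
        H' * ((N : ℤ) • 1 + ∑ i, A.colorMatrix i).map (Int.cast : ℤ → ZMod 2) = 1 := by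
  classical
  obtain ⟨f, hf⟩ := exists_functional_sum_eq_one h_one
  have hS (v w : V) : (((∑ i, A.colorMatrix i) v w : ℤ) : ZMod 2) =
      (∑ i, translationMatrix φ.toEquiv (basisClass C i)) v w := by
    rw [sum_colorMatrix_apply, signOf_cast, Matrix.sum_apply]
    simp only [translationMatrix, of_apply]
    have hadj : A.graph.Adj v w ↔ ∃ i, φ w = φ v + basisClass C i := by
      rw [← cubeQuotient_adj_iff hC, φ.map_adj_iff]
    split_ifs with h
    · obtain ⟨i, hi⟩ := hadj.1 h
      rw [Finset.sum_eq_single i]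
      · exact (if_pos hi).symm
      · intro j _ hj
        refine if_neg fun h' => hj (basisClass_injective hC ?_)
        exact add_left_cancel (h'.symm.trans hi)
      · simp
    · exact (Finset.sum_eq_zero fun i _ => if_neg fun h' => h (hadj.2 ⟨i, h'⟩)).symm
  have hN (v w : V) : ((((N : ℤ) • (1 : Matrix V V ℤ)) v w : ℤ) : ZMod 2) =
      ((N : ZMod 2) • (1 : Matrix V V (ZMod 2))) v w := by
    rw [Matrix.smul_apply, Matrix.smul_apply, one_apply, one_apply]
    split_ifs <;> simp
  obtain ⟨H, H', h⟩ := translation_homotopy φ.toEquiv (basisClass C) basisClass_add_self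
    f.toAddMonoidHom hf (N : ZMod 2)
  refine ⟨H, H', ?_⟩
  rw [← h]
  congr 2
  · ext v w
    rw [map_apply, Matrix.sub_apply, Int.cast_sub, hN, hS, Matrix.sub_apply]
  · ext v w
    rw [map_apply, Matrix.add_apply, Int.cast_add, hN, hS, Matrix.add_apply]

omit [DecidableEq V] in
theorem exists_enumeration_of_alternating_sign (A : Adinkra N V) {ε : V → ℤ}
    (hε : ∀ v, ε v = 1 ∨ ε v = -1) (hadj : ∀ v w, A.graph.Adj v w → ε w = -ε v) :
    ∃ e : V ≃ Fin (Fintype.card V / 2 + Fintype.card V / 2),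
      ∀ v, ε v = 1 ↔ (e v : ℕ) < Fintype.card V / 2 := by
  have hcard := A.card_filter_eq_card_filter hadj
  have hV := A.card_eq
  have h3 : (Finset.univ.filter fun v => ¬ ε v = 1) = Finset.univ.filter fun v => ε v = -1 := by
    ext v
    rcases hε v with h | h <;> simp [h]
  have h2 := Finset.card_filter_add_card_filter_not (s := (Finset.univ : Finset V))
    (fun v => ε v = 1)
  rw [h3, ← hcard, Finset.card_univ] at h2
  have e1 : {v // ε v = 1} ≃ Fin (Fintype.card V / 2) :=
    Fintype.equivFinOfCardEq (by rw [Fintype.card_subtype]; omega)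
  have e2 : {v // ¬ ε v = 1} ≃ Fin (Fintype.card V / 2) :=
    Fintype.equivFinOfCardEq (by rw [Fintype.card_subtype, h3, ← hcard]; omega)
  refine ⟨(Equiv.sumCompl fun v => ε v = 1).symm.trans ((e1.sumCongr e2).trans finSumFinEquiv),
    fun v => ?_⟩
  by_cases h : ε v = 1
  · simp [h, Equiv.sumCompl_symm_apply_of_pos]
  · simp [h, Equiv.sumCompl_symm_apply_of_neg]

/-- With a single color, the matrix `S` of the edges squares to `1`, and `1 - S` is equivalent to
the projection onto one side of the bipartition. -/
theorem hasInvariantFactors_of_one_color (A : Adinkra 1 V) :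
    HasInvariantFactors A.signedLaplacian
      (List.replicate (Fintype.card V / 2) 1 ++ List.replicate (Fintype.card V / 2) 0) := by
  obtain ⟨ε, hε, hadj⟩ := A.exists_alternating_sign
  obtain ⟨e, he⟩ := A.exists_enumeration_of_alternating_sign hε hadj
  let p : V → ℤ := fun v => if ε v = 1 then 1 else 0
  let S := ∑ i, A.colorMatrix i
  have hSS : S * S = 1 := by rw [A.sum_colorMatrix_mul_self]; simp
  have hpp : diagonal p * diagonal p = diagonal p := by
    rw [diagonal_mul_diagonal]
    congr 1
    ext v
    simp only [p]
    split_ifs <;> rfl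
  have hpS : diagonal p * S = S - S * diagonal p := by
    ext v w
    have hS : S v w = A.signOf v w := A.sum_colorMatrix_apply v w
    rw [diagonal_mul, Matrix.sub_apply, mul_diagonal, hS]
    by_cases h : A.graph.Adj v w
    · simp only [p, hadj v w h]
      rcases hε v with h | h <;> simp [h]
    · rw [signOf, dif_neg h]; simp
  -- `S` maps each side of the bipartition to the other. Hence `diagonal p * S` and `S * diagonal p`
  -- square to zero, and adding `1` to either gives an invertible matrix.
  have hpSp : diagonal p * S * diagonal p = 0 := by
    rw [hpS, sub_mul, mul_assoc, hpp, sub_self]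
  have hnil : diagonal p * S * (diagonal p * S) = 0 := by
    rw [← mul_assoc, hpSp, zero_mul]
  have hnil' : S * diagonal p * (S * diagonal p) = 0 := by
    rw [mul_assoc, ← mul_assoc (diagonal p), hpSp, mul_zero]
  have inv_of {X : Matrix V V ℤ} (hX : X * X = 0) :
      (1 + X) * (1 - X) = 1 ∧ (1 - X) * (1 + X) = 1 := by
    constructor <;> simp [add_mul, mul_sub, sub_mul, mul_add, hX]
  refine hasInvariantFactors_of_diagonal
    ⟨1 + S * diagonal p, 1 - S * diagonal p, (inv_of hnil').1, (inv_of hnil').2⟩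
    ⟨1 + diagonal p * S, 1 - diagonal p * S, (inv_of hnil).1, (inv_of hnil).2⟩
    (fun v => if (e v : ℕ) < Fintype.card V / 2 then 1 else 0) ?_ e fun v => rfl
  change (1 + S * diagonal p) * A.signedLaplacian * (1 + diagonal p * S) = _
  have hL : A.signedLaplacian = 1 - S := by rw [A.signedLaplacian_eq]; simp [S]
  -- The row operation clears the rows of the side where `p` is `0`; the column operation then
  -- removes `S` from the remaining rows.
  have hfirst : (1 + S * diagonal p) * (1 - S) = diagonal p * (1 - S) := by
    have h1 : S * diagonal p * S = 1 - diagonal p := by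
      rw [mul_assoc, hpS, mul_sub, ← mul_assoc, hSS, one_mul]
    rw [add_mul, one_mul, mul_sub, mul_sub, h1, mul_one, mul_one, hpS]
    abel
  have hgoal : (1 + S * diagonal p) * A.signedLaplacian * (1 + diagonal p * S) = diagonal p := by
    rw [hL, hfirst, mul_sub, mul_one, sub_mul, mul_add, mul_add, mul_one, mul_one, ← mul_assoc,
      hpp, ← mul_assoc, hpSp, zero_mul]
    abel
  rw [hgoal]
  congr 1
  ext v
  by_cases h : ε v = 1
  · simp [p, h, (he v).1 h]
  · simp [p, h, not_lt.1 fun h' => h ((he v).2 h')]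

end Adinkra

theorem mainTheorem8 {N : ℕ} {V : Type*} [Fintype V] [DecidableEq V] (A : Adinkra N V)
    (C : Submodule (ZMod 2) (Fin N → ZMod 2)) (hC : IsDoublyEven C)
    (hA : Nonempty (A.graph ≃g cubeQuotient C))
    (h_one : (fun _ => 1 : Fin N → ZMod 2) ∉ C) :
    HasInvariantFactors A.signedLaplacian
      (List.replicate (Fintype.card V / 2) 1 ++
        List.replicate (Fintype.card V / 2) (N ^ 2 - N)) := by

  -- For `N = 1` the number `N ^ 2 - N` is `0` and the Laplacian is singular, so the divisor
  -- argument does not apply.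
  rcases eq_or_ne N 1 with rfl | hN
  · exact A.hasInvariantFactors_of_one_color
  · obtain ⟨φ⟩ := hA
    have hd : N ^ 2 - N ≠ 0 := by
      have h2 : 2 ≤ N := by have := A.one_le; omega
      have : N * 2 ≤ N * N := Nat.mul_le_mul_left N h2
      rw [sq]
      omega
    rw [A.signedLaplacian_eq]
    exact hasInvariantFactors_of_homotopies hd A.card_eq A.laplacian_mul A.det_laplacian
      A.laplacian_homotopy (A.laplacian_homotopy_mod_two hC φ h_one)
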